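/- All groups are countable. A free p.m.p. action of a group $\Gamma$ is an essentially free action of $\Gamma$ by measure preserving Borel automorphisms on a standard Borel probability space $(X,\mu)$; its orbit equivalence relation is denoted $\mathcal R_{\alpha(\Gamma)}$, and equivalence relations are considered up to $\mu$-null sets. Given groups $\Gamma_1,\Gamma_2$ with subgroups $\Gamma_1^0<\Gamma_1$ and $\Gamma_2^0<\Gamma_2$, an orbit equivalence of the pairs $(\Gamma_1^0<\Gamma_1)$ and $(\Gamma_2^0<\Gamma_2)$ consists of free p.m.p. actions $\alpha_1$ of $\Gamma_1$ and $\alpha_2$ of $\Gamma_2$ on the same standard Borel probability space $(X,\mu)$ such that $\mathcal R_{\alpha_1(\Gamma_1)}=\mathcal R_{\alpha_2(\Gamma_2)}$ and $\mathcal R_{\alpha_1(\Gamma_1^0)}=\mathcal R_{\alpha_2(\Gamma_2^0)}$. It is strong, via the group isomorphism $\phi:\Gamma_1^0\to\Gamma_2^0$, if moreover for every $\gamma\in\Gamma_1^0$ one has $\alpha_1(\gamma)x=\alpha_2(\phi(\gamma))x$ for $\mu$-almost every $x$. We write $(\Gamma_1^0<\Gamma_1)\overset{OE}{\sim}(\Gamma_2^0<\Gamma_2)$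 if an orbit equivalence of the pairs exists, and $(\Gamma_1^0<\Gamma_1)\underset{st}{\overset{OE}{\sim}}(\Gamma_2^0<\Gamma_2)$ if a strong one (via some isomorphism) exists. Theorem. Let $G$ and $\Gamma_1$ be countable groups, $\Gamma^0<G$ and $\Gamma_1^0<\Gamma_1$ subgroups, and $e_1:\Gamma^0\to\Gamma_1^0$ an isomorphism. (1) Let $\Gamma_2$ be a countable group, $\Gamma_2^0<\Gamma_2$ a subgroup and $e_2:\Gamma^0\to\Gamma_2^0$ an isomorphism. If the pairs $(\Gamma_1^0<\Gamma_1)$ and $(\Gamma_2^0<\Gamma_2)$ admit a strong orbit equivalence of pairs via the isomorphism $e_2\circ e_1^{-1}:\Gamma_1^0\to\Gamma_2^0$, then $$(G<G*_{\Gamma^0=\Gamma_1^0}\Gamma_1)\underset{st}{\overset{OE}{\sim}}(G<G*_{\Gamma^0=\Gamma_2^0}\Gamma_2),$$ where the amalgamated free products are formed along $e_1$ and $e_2$ respectively. (2) In particular, let $\Gamma_2'$ be a countable group. If $(\Gamma_1^0<\Gamma_1)\overset{OE}{\sim}(\Gamma_1^0<\Gamma_1^0*\Gamma_2')$ (an orbit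 equivalence of pairs, not necessarily strong), then $$(G<G*_{\Gamma^0=\Gamma_1^0}\Gamma_1)\underset{st}{\overset{OE}{\sim}}(G<G*\Gamma_2').$$ -/

import Mathlib

open MeasureTheory

universe u

/-! ## Amalgamated free products of two groups -/

/-- The family of groups `G`, `K`, indexed by the two booleans. -/
def AmalgFactor (G K : Type u) : Bool → Type u
  | false => G
  | true => K

instance AmalgFactor.instGroup (G K : Type u) [Group G] [Group K] :
    (b : Bool) → Group (AmalgFactor G K b)
  | false => inferInstanceAs (Group G)
  | true => inferInstanceAs (Group K)

/-- The family of the two homomorphisms `f : H → G` and `k : H → K`. -/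
def amalgMap {H G K : Type u} [Group H] [Group G] [Group K] (f : H →* G) (k : H →* K) :
    (b : Bool) → H →* AmalgFactor G K b
  | false => f
  | true => k

/-- The amalgamated free product `G *_H K` along `f : H → G` and `k : H → K` (used below only for
injective `f` and `k`), as a pushout of groups. -/
abbrev AmalgProd {H G K : Type u} [Group H] [Group G] [Group K] (f : H →* G) (k : H →* K) :
    Type u :=
  Monoid.PushoutI (amalgMap f k)

/-- The canonical homomorphism `G → G *_H K`. -/
def AmalgProd.inl {H G K : Type u} [Group H] [Group G] [Group K] (f : H →* G) (k : H →* K) :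
    G →* AmalgProd f k :=
  Monoid.PushoutI.of (φ := amalgMap f k) false

/-! ## Orbit equivalence of pairs of groups -/

/-- `α` is an essentially free action of `Γ` on `X` by measurable transformations that preserve the
measure `μ`. -/
structure IsFreePMP {Γ X : Type*} [Group Γ] [MeasurableSpace X] (μ : Measure X)
    (α : Γ →* Equiv.Perm X) : Prop where
  measurePreserving : ∀ g : Γ, MeasurePreserving (α g) μ μ
  essentiallyFree : ∀ᵐ x ∂μ, ∀ g : Γ, α g x = x → g = 1

/-- The subgroups `H₁` and `H₂`, acting through `α₁` and `α₂`, have the same orbit equivalence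
relation up to a null set: the two orbits of almost every point coincide. -/
def SameOrbits {Γ₁ Γ₂ X : Type*} [Group Γ₁] [Group Γ₂] [MeasurableSpace X] (μ : Measure X)
    (α₁ : Γ₁ →* Equiv.Perm X) (H₁ : Subgroup Γ₁) (α₂ : Γ₂ →* Equiv.Perm X) (H₂ : Subgroup Γ₂) :
    Prop :=
  ∀ᵐ x ∂μ, ∀ y : X, (∃ g ∈ H₁, α₁ g x = y) ↔ (∃ g ∈ H₂, α₂ g x = y)

/-- `α₁` and `α₂` form an orbit equivalence of the pairs `H₁ < Γ₁` and `H₂ < Γ₂` on `(X, μ)`. -/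
structure IsPairOE {Γ₁ Γ₂ X : Type*} [Group Γ₁] [Group Γ₂] [MeasurableSpace X] (μ : Measure X)
    (H₁ : Subgroup Γ₁) (H₂ : Subgroup Γ₂)
    (α₁ : Γ₁ →* Equiv.Perm X) (α₂ : Γ₂ →* Equiv.Perm X) : Prop where
  left : IsFreePMP μ α₁
  right : IsFreePMP μ α₂
  sameOrbits : SameOrbits μ α₁ ⊤ α₂ ⊤
  sameSubOrbits : SameOrbits μ α₁ H₁ α₂ H₂

/-- The pairs `H₁ < Γ₁` and `H₂ < Γ₂` admit an orbit equivalence of pairs, on some standard Borel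
probability space. (Every standard Borel space is isomorphic to one whose points form a type in the
lowest universe, so taking `X : Type` loses nothing.) -/
def PairOE {Γ₁ Γ₂ : Type*} [Group Γ₁] [Group Γ₂] (H₁ : Subgroup Γ₁) (H₂ : Subgroup Γ₂) : Prop :=
  ∃ (X : Type) (_ : MeasurableSpace X) (_ : StandardBorelSpace X)
    (μ : Measure X) (_ : IsProbabilityMeasure μ)
    (α₁ : Γ₁ →* Equiv.Perm X) (α₂ : Γ₂ →* Equiv.Perm X),
    IsPairOE μ H₁ H₂ α₁ α₂

/-- The pairs `H₁ < Γ₁` and `H₂ < Γ₂` admit a strong orbit equivalence of pairs whose isomorphism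
of the subgroups is `φ`: the actions of `γ` and of `φ γ` agree almost everywhere. -/
def StrongPairOEVia {Γ₁ Γ₂ : Type*} [Group Γ₁] [Group Γ₂] (H₁ : Subgroup Γ₁) (H₂ : Subgroup Γ₂)
    (φ : H₁ ≃* H₂) : Prop :=
  ∃ (X : Type) (_ : MeasurableSpace X) (_ : StandardBorelSpace X)
    (μ : Measure X) (_ : IsProbabilityMeasure μ)
    (α₁ : Γ₁ →* Equiv.Perm X) (α₂ : Γ₂ →* Equiv.Perm X),
    IsPairOE μ H₁ H₂ α₁ α₂ ∧
      ∀ γ : H₁, ∀ᵐ x ∂μ, α₁ (γ : Γ₁) x = α₂ (φ γ : Γ₂) x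

/-- The pairs `H₁ < Γ₁` and `H₂ < Γ₂` admit a strong orbit equivalence of pairs. -/
def StrongPairOE {Γ₁ Γ₂ : Type*} [Group Γ₁] [Group Γ₂] (H₁ : Subgroup Γ₁) (H₂ : Subgroup Γ₂) :
    Prop :=
  ∃ φ : H₁ ≃* H₂, StrongPairOEVia H₁ H₂ φ

/-! Co-induction turns the action `α₁` of `Γ₁` on `X` into an action of `G *_H Γ₁`; its product with
a Bernoulli action is free, and has a `Γ₁`-equivariant map to `X`
(`exists_free_extension_of_injective`). Along this map the orbit cocycle of the given equivalence
lifts: `Γ₂` acts upstairs with the orbits of `Γ₁` (`exists_lift_of_sameOrbits`). Strongness makes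
the lifted action agree with the old one on `H`, so it glues with the unchanged action of `G` to an
action of `G *_H Γ₂`. Orbits agree because they agree on generators.

Freeness is the crux (`amalgam_action_free`). At a given point, each letter of `Γ₂` outside `H`
moves the current point like some letter of `Γ₁` outside `H`. A reduced word of one amalgam thus
acts at that point like a reduced word of the other with the same pattern of factors, and a nonempty
one fixes nothing.

For part (2), the same trading of letters, over the trivial group, replaces the action of the factor
`H` of `H * L` by the one coming from `Γ₁`. This makes the equivalence strong, and `G *_H (H * L)`
is `G * L`.

Null sets are discarded beforehand by passing to invariant conull sets, so cocycles and words are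
handled at every point. -/

/-! ## Free actions of amalgamated products -/

section Amalgam

open Monoid

variable {ι H Y : Type*} {G₁ G₂ : ι → Type*} [∀ i, Group (G₁ i)] [∀ i, Group (G₂ i)] [Group H]
  {φ₁ : ∀ i, H →* G₁ i} {φ₂ : ∀ i, H →* G₂ i}

/-- Every element of an amalgamated product is an element of the base times a reduced word. -/
theorem exists_base_mul_reduced_word (hφ : ∀ i, Function.Injective (φ₂ i)) (x : PushoutI φ₂) :
    ∃ (h : H) (w : CoprodI.Word G₂), PushoutI.Reduced φ₂ w ∧
      x = PushoutI.base φ₂ h * PushoutI.ofCoprodI w.prod := by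
  classical
  obtain ⟨d⟩ := PushoutI.NormalWord.transversal_nonempty φ₂ hφ
  obtain ⟨w, rfl⟩ := (PushoutI.NormalWord.equiv (d := d)).symm.surjective x
  refine ⟨w.head, w.toWord, ?_, rfl⟩
  rintro ⟨i, g⟩ hg ⟨h, hh⟩
  have hd := w.normalized i g hg
  have hmem : g ∈ (φ₂ i).range := ⟨h, hh⟩
  -- A letter in the transversal represents its own coset, while a letter from the base has
  -- representative 1; both together make the letter trivial.
  have h1 := (d.compl i).equiv_snd_eq_self_of_mem_of_one_mem (one_mem _) hd
  have h2 := ((d.compl i).coe_equiv_snd_eq_one_iff_mem (d.one_mem i)).2 hmem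
  rw [h1] at h2
  exact w.ne_one _ hg h2

/-- If the letters of one amalgamated product act pointwise like letters of another one, with the
letters of the base acting equally, then freeness is inherited. -/
theorem amalgam_action_free (hφ₁ : ∀ i, Function.Injective (φ₁ i))
    (hφ₂ : ∀ i, Function.Injective (φ₂ i))
    (β₁ : PushoutI φ₁ →* Equiv.Perm Y) (β₂ : PushoutI φ₂ →* Equiv.Perm Y)
    (hfree : ∀ y g, β₁ g y = y → g = 1)
    (hbase : ∀ h, β₁ (PushoutI.base φ₁ h) = β₂ (PushoutI.base φ₂ h))
    (hletter : ∀ i (g : G₂ i) y, g ∉ (φ₂ i).range → ∃ g' : G₁ i, g' ∉ (φ₁ i).range ∧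
      β₂ (PushoutI.of i g) y = β₁ (PushoutI.of i g') y)
    (y : Y) (x : PushoutI φ₂) (hx : β₂ x y = y) : x = 1 := by
  obtain ⟨h, w, hw, rfl⟩ := exists_base_mul_reduced_word hφ₂ x
  -- Letters are traded from the right: the replacement of a letter depends on the point to which
  -- the rest of the word has carried `y`.
  have key : ∀ l : List (Σ i, G₂ i), (∀ g ∈ l, g.2 ∉ (φ₂ g.1).range) →
      ∃ l' : List (Σ i, G₁ i), (∀ g ∈ l', g.2 ∉ (φ₁ g.1).range) ∧
        l'.map Sigma.fst = l.map Sigma.fst ∧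
        β₂ (PushoutI.ofCoprodI (l.map fun g => CoprodI.of g.2).prod) y =
          β₁ (PushoutI.ofCoprodI (l'.map fun g => CoprodI.of g.2).prod) y := by
    intro l
    induction l with
    | nil => exact fun _ => ⟨[], by simp⟩
    | cons a l ih =>
      intro hl
      obtain ⟨l', h1, h2, h3⟩ := ih fun g hg => hl g (List.mem_cons_of_mem _ hg)
      obtain ⟨g', h4, h5⟩ := hletter a.1 a.2
        (β₂ (PushoutI.ofCoprodI (l.map fun g => CoprodI.of g.2).prod) y) (hl a List.mem_cons_self)
      refine ⟨⟨a.1, g'⟩ :: l', ?_, by simp [h2], ?_⟩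
      · simpa using ⟨by simpa using h4, by simpa using h1⟩
      · simp only [List.map_cons, List.prod_cons, map_mul, PushoutI.ofCoprodI_of,
          Equiv.Perm.mul_apply]
        rw [h5, h3]
  obtain ⟨l', h1, h2, h3⟩ := key w.toList hw
  -- The traded letters lie in the same sequence of factors, so neighbours still come from different
  -- ones.
  let w' : CoprodI.Word G₁ := ⟨l', fun a ha h0 => h1 a ha (h0 ▸ one_mem _), by
    have := w.chain_ne
    rw [← List.isChain_map (R := fun a b => a ≠ b) Sigma.fst, ← h2, List.isChain_map] at this
    exact this⟩
  have h4 : β₁ (PushoutI.base φ₁ h * PushoutI.ofCoprodI w'.prod) y = y := by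
    rw [map_mul, Equiv.Perm.mul_apply] at hx ⊢
    rw [hbase]
    exact (congrArg _ h3.symm).trans hx
  have h5 := hfree _ _ h4
  -- Freeness puts the traded word into the base, where only the empty word is reduced.
  have h6 : w' = .empty := PushoutI.Reduced.eq_empty_of_mem_range hφ₁ h1
    ⟨h⁻¹, by rw [map_inv]; exact inv_eq_of_mul_eq_one_right h5⟩
  have h7 : l' = [] := congrArg CoprodI.Word.toList h6
  have h8 : w = .empty := by
    ext1
    have : w.toList.map Sigma.fst = [] := by rw [← h2, h7]; rfl
    simpa [CoprodI.Word.empty] using this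
  have h9 : h = 1 := by
    apply PushoutI.base_injective hφ₁
    rw [h6] at h5
    simpa using h5
  simp [h8, h9]

/-- If the letters of one amalgamated product act pointwise like letters of another one, its orbits
are contained in those of the other one. -/
theorem amalgam_orbit_subset {K : Type*} [Group K]
    (β₁ : K →* Equiv.Perm Y) (β₂ : PushoutI φ₂ →* Equiv.Perm Y)
    (hbase : ∀ h y, ∃ k, β₂ (PushoutI.base φ₂ h) y = β₁ k y)
    (hletter : ∀ i (g : G₂ i) y, ∃ k, β₂ (PushoutI.of i g) y = β₁ k y)
    (x : PushoutI φ₂) (y : Y) : ∃ k, β₂ x y = β₁ k y := by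
  induction x using PushoutI.induction_on generalizing y with
  | of i g => exact hletter i g y
  | base h => exact hbase h y
  | mul a b iha ihb =>
    obtain ⟨k, hk⟩ := ihb y
    obtain ⟨l, hl⟩ := iha (β₁ k y)
    exact ⟨l * k, by simp [hk, hl]⟩

theorem amalgam_countable [Countable ι] [∀ i, Countable (G₂ i)] [Countable H] :
    Countable (PushoutI φ₂) := by
  have h1 : Countable (CoprodI G₂) := by
    have : Countable (FreeMonoid (Σ i, G₂ i)) := inferInstanceAs (Countable (List _))
    exact Function.Surjective.countable (Con.mk'_surjective (c := conGen (CoprodI.Rel G₂)))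
  have h2 : Countable (Coprod (CoprodI G₂) H) := by
    have : Countable (FreeMonoid (CoprodI G₂ ⊕ H)) := inferInstanceAs (Countable (List _))
    exact Function.Surjective.countable (Coprod.mk_surjective)
  exact Function.Surjective.countable (Con.mk'_surjective (c := PushoutI.con φ₂))

end Amalgam

/-! ## Strictly free actions and restriction to conull sets -/

section Strict

variable {Γ X : Type*} [Group Γ]

/-- `α` is an action by measurable transformations preserving `μ` that is free at every point. -/
structure IsStrictlyFreePMP [MeasurableSpace X] (μ : Measure X) (α : Γ →* Equiv.Perm X) :
    Prop where
  measurePreserving : ∀ g : Γ, MeasurePreserving (α g) μ μ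
  free : ∀ x g, α g x = x → g = 1

theorem IsStrictlyFreePMP.isFreePMP [MeasurableSpace X] {μ : Measure X}
    {α : Γ →* Equiv.Perm X} (h : IsStrictlyFreePMP μ α) : IsFreePMP μ α :=
  ⟨h.measurePreserving, .of_forall h.free⟩

theorem IsStrictlyFreePMP.eq_of_apply_eq [MeasurableSpace X] {μ : Measure X}
    {α : Γ →* Equiv.Perm X} (h : IsStrictlyFreePMP μ α) {g k : Γ} {x : X}
    (hx : α g x = α k x) : g = k := by
  refine (inv_mul_eq_one.1 (h.free x (k⁻¹ * g) ?_)).symm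
  rw [map_mul, Equiv.Perm.mul_apply, hx, ← Equiv.Perm.mul_apply, ← map_mul]
  simp

theorem IsStrictlyFreePMP.comp [MeasurableSpace X] {μ : Measure X}
    {α : Γ →* Equiv.Perm X} (h : IsStrictlyFreePMP μ α) {K : Type*} [Group K] (j : K →* Γ)
    (hj : Function.Injective j) : IsStrictlyFreePMP μ (α.comp j) :=
  ⟨fun g => h.measurePreserving (j g), fun x g hg => hj (by rw [h.free x (j g) hg, map_one])⟩

/-- The restriction of an action to an invariant set. -/
def restrictAction (α : Γ →* Equiv.Perm X) (S : Set X) (hS : ∀ g, ∀ x ∈ S, α g x ∈ S) :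
    Γ →* Equiv.Perm S where
  toFun g := (α g).subtypePerm fun x =>
    ⟨fun h => by simpa using hS g⁻¹ _ h, hS g x⟩
  map_one' := by ext; simp
  map_mul' g h := by
    ext x
    change α (g * h) x = α g (α h x)
    simp

@[simp]
theorem coe_restrictAction (α : Γ →* Equiv.Perm X) (S : Set X)
    (hS : ∀ g, ∀ x ∈ S, α g x ∈ S) (g : Γ) (x : S) :
    (restrictAction α S hS g x : X) = α g x := rfl

variable [MeasurableSpace X] {μ : Measure X}

theorem restrictAction_measurePreserving {α : Γ →* Equiv.Perm X} {S : Set X}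
    (hS : ∀ g, ∀ x ∈ S, α g x ∈ S) (hSm : MeasurableSet S)
    (hα : ∀ g, MeasurePreserving (α g) μ μ) (g : Γ) :
    MeasurePreserving (restrictAction α S hS g) (μ.comap ((↑) : S → X))
      (μ.comap ((↑) : S → X)) := by
  have he := MeasurableEmbedding.subtype_coe hSm
  have hm : Measurable (restrictAction α S hS g) :=
    ((hα g).measurable.comp measurable_subtype_coe).subtype_mk
  refine ⟨hm, Measure.ext fun B hB => ?_⟩
  rw [Measure.map_apply hm hB, he.comap_apply, he.comap_apply,
    ← (hα g).measure_preimage (he.measurableSet_image.2 hB).nullMeasurableSet]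
  congr 1
  ext x
  constructor
  · rintro ⟨y, hy, rfl⟩
    exact ⟨_, hy, rfl⟩
  · rintro ⟨y, hy, hyx⟩
    have hx : x ∈ S := by
      have := hS g⁻¹ _ y.2
      rw [hyx] at this
      simpa using this
    refine ⟨⟨x, hx⟩, ?_, rfl⟩
    have : restrictAction α S hS g ⟨x, hx⟩ = y := Subtype.ext hyx.symm
    simpa [this] using hy

theorem isProbabilityMeasure_comap_subtype [IsProbabilityMeasure μ] {S : Set X}
    (hSm : MeasurableSet S) (hS : ∀ᵐ x ∂μ, x ∈ S) :
    IsProbabilityMeasure (μ.comap ((↑) : S → X)) := by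
  constructor
  rw [(MeasurableEmbedding.subtype_coe hSm).comap_apply, Set.image_univ, Subtype.range_coe,
    prob_compl_eq_zero_iff hSm |>.1 hS]

/-- The measure preserving inclusion of a conull set. -/
theorem measurePreserving_subtype_coe {S : Set X}
    (hSm : MeasurableSet S) (hS : ∀ᵐ x ∂μ, x ∈ S) :
    MeasurePreserving ((↑) : S → X) (μ.comap ((↑) : S → X)) μ := by
  refine ⟨measurable_subtype_coe, ?_⟩
  rw [(MeasurableEmbedding.subtype_coe hSm).map_comap, Subtype.range_coe,
    Measure.restrict_eq_self_of_ae_mem hS]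

/-- A property that holds almost everywhere holds on an invariant conull measurable set. -/
theorem exists_invariant_conull [Countable Γ] {α : Γ →* Equiv.Perm X}
    (hα : ∀ g, MeasurePreserving (α g) μ μ) {P : X → Prop} (hP : ∀ᵐ x ∂μ, P x) :
    ∃ S : Set X, MeasurableSet S ∧ (∀ᵐ x ∂μ, x ∈ S) ∧ (∀ g, ∀ x ∈ S, α g x ∈ S) ∧
      ∀ x ∈ S, P x := by
  obtain ⟨T, hT, hTm, hT0⟩ := exists_measurable_superset_of_null hP
  -- The points whose whole orbit avoids the null set `T`.
  refine ⟨⋂ g, (α g) ⁻¹' Tᶜ, .iInter fun g => (hα g).measurable hTm.compl, ?_, ?_, ?_⟩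
  · simp only [Set.mem_iInter]
    exact ae_all_iff.2 fun g => (hα g).quasiMeasurePreserving.ae
      (measure_eq_zero_iff_ae_notMem.1 hT0)
  · intro g x hx
    simp only [Set.mem_iInter, Set.mem_preimage] at hx ⊢
    intro k
    simpa using hx (k * g)
  · intro x hx
    have h1 : x ∈ Tᶜ := by simpa using Set.mem_iInter.1 hx 1
    by_contra h2
    exact h1 (hT h2)

end Strict

/-- Two strictly free actions whose orbits, and orbits of subgroups, coincide at every point. -/
structure IsStrictPairOE {Γ₁ Γ₂ X : Type*} [Group Γ₁] [Group Γ₂] [MeasurableSpace X]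
    (μ : Measure X) (H₁ : Subgroup Γ₁) (H₂ : Subgroup Γ₂)
    (α₁ : Γ₁ →* Equiv.Perm X) (α₂ : Γ₂ →* Equiv.Perm X) : Prop where
  left : IsStrictlyFreePMP μ α₁
  right : IsStrictlyFreePMP μ α₂
  orbit : ∀ x y, (∃ g, α₁ g x = y) ↔ ∃ g, α₂ g x = y
  subOrbit : ∀ x y, (∃ g ∈ H₁, α₁ g x = y) ↔ ∃ g ∈ H₂, α₂ g x = y

theorem IsStrictPairOE.isPairOE {Γ₁ Γ₂ X : Type*} [Group Γ₁] [Group Γ₂] [MeasurableSpace X]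
    {μ : Measure X} {H₁ : Subgroup Γ₁} {H₂ : Subgroup Γ₂}
    {α₁ : Γ₁ →* Equiv.Perm X} {α₂ : Γ₂ →* Equiv.Perm X} (h : IsStrictPairOE μ H₁ H₂ α₁ α₂) :
    IsPairOE μ H₁ H₂ α₁ α₂ where
  left := h.left.isFreePMP
  right := h.right.isFreePMP
  sameOrbits := .of_forall fun x y => by simpa using h.orbit x y
  sameSubOrbits := .of_forall h.subOrbit

/-- An orbit equivalence of pairs becomes strict on a conull set invariant under both actions. -/
theorem IsPairOE.exists_strict {Γ₁ Γ₂ X : Type*} [Group Γ₁] [Group Γ₂] [Countable Γ₁]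
    [MeasurableSpace X] {μ : Measure X} {H₁ : Subgroup Γ₁} {H₂ : Subgroup Γ₂}
    {α₁ : Γ₁ →* Equiv.Perm X} {α₂ : Γ₂ →* Equiv.Perm X} (h : IsPairOE μ H₁ H₂ α₁ α₂)
    {P : X → Prop} (hP : ∀ᵐ x ∂μ, P x) :
    ∃ (S : Set X) (h₁ : ∀ g, ∀ x ∈ S, α₁ g x ∈ S) (h₂ : ∀ g, ∀ x ∈ S, α₂ g x ∈ S),
      MeasurableSet S ∧ (∀ᵐ x ∂μ, x ∈ S) ∧ (∀ x ∈ S, P x) ∧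
      IsStrictPairOE (μ.comap ((↑) : S → X)) H₁ H₂ (restrictAction α₁ S h₁)
        (restrictAction α₂ S h₂) := by
  obtain ⟨S, hSm, hS, h₁, hSP⟩ := exists_invariant_conull h.left.measurePreserving
    (h.left.essentiallyFree.and (h.right.essentiallyFree.and
      (h.sameOrbits.and (h.sameSubOrbits.and hP))))
  -- Invariance under `α₂` is automatic, since the orbits coincide on `S`; only `Γ₁` has to be
  -- countable.
  have h₂ : ∀ g, ∀ x ∈ S, α₂ g x ∈ S := by
    intro g x hx
    obtain ⟨k, -, hk⟩ := ((hSP x hx).2.2.1 (α₂ g x)).2 ⟨g, trivial, rfl⟩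
    exact hk ▸ h₁ k x hx
  refine ⟨S, h₁, h₂, hSm, hS, fun x hx => (hSP x hx).2.2.2.2,
    ⟨restrictAction_measurePreserving h₁ hSm h.left.measurePreserving,
      fun x g hg => (hSP x x.2).1 g (congrArg Subtype.val hg)⟩,
    ⟨restrictAction_measurePreserving h₂ hSm h.right.measurePreserving,
      fun x g hg => (hSP x x.2).2.1 g (congrArg Subtype.val hg)⟩, fun x y => ?_, fun x y => ?_⟩
  · simpa [Subtype.ext_iff] using (hSP x x.2).2.2.1 y
  · simpa [Subtype.ext_iff] using (hSP x x.2).2.2.2.1 y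

/-- A transformation that is pointwise given by a measure preserving action of a countable group,
on measurable pieces, is measure preserving. -/
theorem measurePreserving_of_piecewise {Λ Y : Type*} [Group Λ] [Countable Λ] [MeasurableSpace Y]
    {μ : Measure Y} {β : Λ →* Equiv.Perm Y} (hβ : ∀ g, MeasurePreserving (β g) μ μ)
    (σ : Equiv.Perm Y) (c : Y → Λ) (hc : ∀ k, MeasurableSet (c ⁻¹' {k}))
    (hσ : ∀ y, σ y = β (c y) y) : MeasurePreserving σ μ μ := by
  have hpre : ∀ B, σ ⁻¹' B = ⋃ k, (c ⁻¹' {k} ∩ β k ⁻¹' B) := by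
    intro B
    ext y
    simp [hσ]
  have himg : ∀ k, β k⁻¹ ⁻¹' (c ⁻¹' {k}) = σ '' (c ⁻¹' {k}) := by
    intro k
    ext y
    constructor
    · intro hy
      have hy' : c (β k⁻¹ y) = k := hy
      exact ⟨_, hy, by rw [hσ, hy']; simp⟩
    · rintro ⟨z, hz, rfl⟩
      have hz' : c z = k := hz
      simp [hσ, hz']
  have hm : ∀ {B}, MeasurableSet B → ∀ k, MeasurableSet (c ⁻¹' {k} ∩ β k ⁻¹' B) :=
    fun hB k => (hc k).inter ((hβ k).measurable hB)
  have hσm : Measurable σ := fun B hB => by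
    rw [hpre]
    exact .iUnion (hm hB)
  refine ⟨hσm, Measure.ext fun B hB => ?_⟩
  have hd : Pairwise (Function.onFun Disjoint fun k => c ⁻¹' {k}) := fun k l hkl =>
    Set.disjoint_left.2 fun y (hy : c y = k) (hy' : c y = l) => hkl (hy ▸ hy')
  -- As `σ` is bijective, the images of the pieces also partition the space, and the measures are
  -- compared piece by piece.
  have hB' : B = ⋃ k, (σ '' (c ⁻¹' {k}) ∩ B) := by
    rw [← Set.iUnion_inter, ← Set.image_iUnion]
    have : ⋃ k, c ⁻¹' {k} = Set.univ := by ext; simp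
    rw [this, Set.image_univ, σ.surjective.range_eq, Set.univ_inter]
  rw [Measure.map_apply hσm hB, hpre, measure_iUnion
    (fun k l hkl => (hd hkl).mono Set.inter_subset_left Set.inter_subset_left) (hm hB)]
  conv_rhs => rw [hB']
  rw [measure_iUnion]
  · refine tsum_congr fun k => ?_
    rw [← himg, ← (hβ k).measure_preimage
      (((hβ k⁻¹).measurable (hc k)).inter hB).nullMeasurableSet]
    congr 1
    ext y
    simp
  · exact fun k l hkl => ((Set.disjoint_image_iff σ.injective).2 (hd hkl)).mono
      Set.inter_subset_left Set.inter_subset_left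
  · exact fun k => by
      rw [← himg]
      exact ((hβ k⁻¹).measurable (hc k)).inter hB

/-! ## Extension of actions to larger groups -/

section Extension

/-- Permuting the coordinates and moving each of them separately both preserve a power of `μ`.
Co-induced and Bernoulli actions are of this form. -/
theorem measurePreserving_twist {ι X : Type*} [MeasurableSpace X] (μ : Measure X)
    [IsProbabilityMeasure μ] (e : Equiv.Perm ι) (a : ι → X → X)
    (ha : ∀ i, MeasurePreserving (a i) μ μ) :
    MeasurePreserving (fun (f : ι → X) i => a i (f (e i)))
      (Measure.infinitePi fun _ : ι => μ) (Measure.infinitePi fun _ : ι => μ) := by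
  have h1 : MeasurePreserving (fun (f : ι → X) i => f (e i))
      (Measure.infinitePi fun _ : ι => μ) (Measure.infinitePi fun _ : ι => μ) := by
    refine ⟨by fun_prop, ?_⟩
    have h := Measure.infinitePi_map_piCongrLeft (fun _ : ι => μ) e.symm
    have h' : ⇑(MeasurableEquiv.piCongrLeft (fun _ => X) e.symm) = fun f i => f (e i) := by
      ext f i
      simp [MeasurableEquiv.piCongrLeft, Equiv.piCongrLeft, Equiv.piCongrLeft']
    rwa [h'] at h
  have h2 : MeasurePreserving (fun (f : ι → X) i => a i (f i))
      (Measure.infinitePi fun _ : ι => μ) (Measure.infinitePi fun _ : ι => μ) := by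
    refine ⟨measurable_pi_iff.2 fun i => (ha i).measurable.comp (measurable_pi_apply i), ?_⟩
    rw [Measure.infinitePi_map_pi _ fun i => (ha i).measurable]
    simp only [(ha _).map_eq]
  exact h2.comp h1

/-- Co-induction: an action of a subgroup is a factor of an action of the whole group. -/
theorem exists_coinduced {Λ : Type} [Group Λ] [Countable Λ] (H : Subgroup Λ)
    {X : Type} [MeasurableSpace X] [StandardBorelSpace X] (μ : Measure X) [IsProbabilityMeasure μ]
    (α : H →* Equiv.Perm X) (hα : ∀ h, MeasurePreserving (α h) μ μ) :
    ∃ (Y : Type) (_ : MeasurableSpace Y) (_ : StandardBorelSpace Y) (ν : Measure Y)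
      (_ : IsProbabilityMeasure ν) (β : Λ →* Equiv.Perm Y) (p : Y → X),
      (∀ g, MeasurePreserving (β g) ν ν) ∧ MeasurePreserving p ν μ ∧
      ∀ (h : H) y, p (β h y) = α h (p y) := by
  have : Countable (Λ ⧸ H) := Quotient.mk_surjective.countable
  -- The cocycle of the section `Quotient.out`, recording how far translation by `g` is from
  -- preserving the section.
  let k (g : Λ) (t : Λ ⧸ H) : H := ⟨t.out⁻¹ * g * (g⁻¹ • t).out, by
    have h : (g⁻¹ * t.out : Λ) = ((g⁻¹ • t).out : Λ ⧸ H) := by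
      rw [QuotientGroup.out_eq', ← smul_eq_mul, ← MulAction.Quotient.smul_mk,
        QuotientGroup.out_eq']
    have := QuotientGroup.eq.1 h
    simpa [mul_assoc] using this⟩
  have hk : ∀ g g' t, k (g * g') t = k g t * k g' (g⁻¹ • t) := by
    intro g g' t
    ext
    simp [k, mul_assoc, mul_smul]
  let b : Λ →* Function.End (Λ ⧸ H → X) :=
    { toFun := fun g f t => α (k g t) (f (g⁻¹ • t))
      map_one' := by
        funext f t
        have : k 1 t = 1 := by ext; simp [k]
        change _ = f t
        simp [this]
      map_mul' := by
        intro g g'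
        funext f t
        change _ = α (k g t) (α (k g' (g⁻¹ • t)) (f (g'⁻¹ • g⁻¹ • t)))
        simp [hk, mul_smul] }
  have hb : ∀ g f t, b.toHomPerm g f t = α (k g t) (f (g⁻¹ • t)) := fun _ _ _ => rfl
  let t₀ : Λ ⧸ H := ((1 : Λ) : Λ ⧸ H)
  -- The chosen representative of the trivial coset need not be 1. The cocycle at `t₀` is
  -- conjugation by it, so evaluation at `t₀` becomes equivariant once corrected by `α s₀`.
  let s₀ : H := ⟨t₀.out, by
    have : ((1 : Λ) : Λ ⧸ H) = (t₀.out : Λ ⧸ H) := by rw [QuotientGroup.out_eq']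
    simpa using QuotientGroup.eq.1 this⟩
  refine ⟨Λ ⧸ H → X, inferInstance, inferInstance, Measure.infinitePi fun _ => μ, inferInstance,
    b.toHomPerm, fun f => α s₀ (f t₀), fun g => ?_, ?_, fun h f => ?_⟩
  · exact measurePreserving_twist μ (MulAction.toPerm g⁻¹) (fun t => α (k g t)) fun t => hα _
  · exact (hα s₀).comp (measurePreserving_eval_infinitePi (fun _ : Λ ⧸ H => μ) t₀)
  · have ht : (h⁻¹ : Λ) • t₀ = t₀ := by
      change (((h⁻¹ : Λ) * 1 : Λ) : Λ ⧸ H) = ((1 : Λ) : Λ ⧸ H)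
      rw [QuotientGroup.eq]
      simp
    have hk₀ : k h t₀ = s₀⁻¹ * h * s₀ := by
      ext
      simp [k, s₀, ht]
    simp only [hb, ht, hk₀]
    rw [← Equiv.Perm.mul_apply, ← map_mul, ← Equiv.Perm.mul_apply, ← map_mul]
    congr 2
    group

/-- Every countable group has an essentially free probability measure preserving action. -/
theorem exists_bernoulli (Λ : Type) [Group Λ] [Countable Λ] :
    ∃ (Y : Type) (_ : MeasurableSpace Y) (_ : StandardBorelSpace Y) (ν : Measure Y)
      (_ : IsProbabilityMeasure ν) (β : Λ →* Equiv.Perm Y), IsFreePMP ν β := by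
  let b : Λ →* Function.End (Λ → unitInterval) :=
    { toFun := fun g f t => f (g⁻¹ * t)
      map_one' := by
        funext f t
        change _ = f t
        simp
      map_mul' := by
        intro g g'
        funext f t
        change _ = f (g'⁻¹ * (g⁻¹ * t))
        simp [mul_assoc] }
  refine ⟨Λ → unitInterval, inferInstance, inferInstance, Measure.infinitePi fun _ => volume,
    inferInstance, b.toHomPerm, fun g => ?_, ae_all_iff.2 fun g => ?_⟩
  · exact measurePreserving_twist volume (Equiv.mulLeft g⁻¹) (fun _ => id)
      fun _ => MeasurePreserving.id _
  · by_cases hg : g = 1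
    · simp [hg]
    -- A fixed configuration has equal values at `g` and at `1`, which are independent with an
    -- atomless law. Such a base space serves finite groups as well.
    · have h1 := Measure.infinitePi_map_eval_prod
        (P := fun _ : Λ => (volume : Measure unitInterval)) (i := g) (j := 1) hg
      have h2 : ∀ᵐ p ∂((volume : Measure unitInterval).prod volume), p.1 ≠ p.2 := by
        refine (Measure.ae_prod_iff_ae_ae (p := fun p : unitInterval × unitInterval => p.1 ≠ p.2)
          (measurableSet_eq_fun measurable_fst measurable_snd).compl).2 (.of_forall fun x => ?_)
        have : ∀ᵐ y ∂(volume : Measure unitInterval), y ≠ x := by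
          simp [ae_iff]
        filter_upwards [this] with y hy using hy.symm
      rw [← h1] at h2
      filter_upwards [ae_of_ae_map (by fun_prop) h2] with f hf hgf
      have h3 := congrFun hgf g
      have h4 : f (g⁻¹ * g) = f g := h3
      rw [inv_mul_cancel] at h4
      exact absurd h4.symm hf

/-- A measure preserving action of a subgroup is a factor of a strictly free measure preserving
action of the whole group. -/
theorem exists_free_extension {Λ : Type} [Group Λ] [Countable Λ] (H : Subgroup Λ)
    {X : Type} [MeasurableSpace X] [StandardBorelSpace X] (μ : Measure X) [IsProbabilityMeasure μ]
    (α : H →* Equiv.Perm X) (hα : ∀ h, MeasurePreserving (α h) μ μ) :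
    ∃ (Y : Type) (_ : MeasurableSpace Y) (_ : StandardBorelSpace Y) (ν : Measure Y)
      (_ : IsProbabilityMeasure ν) (β : Λ →* Equiv.Perm Y) (p : Y → X),
      IsStrictlyFreePMP ν β ∧ MeasurePreserving p ν μ ∧ ∀ (h : H) y, p (β h y) = α h (p y) := by
  obtain ⟨Y₁, _, _, ν₁, _, β₁, p, hβ₁, hp, hpα⟩ := exists_coinduced H μ α hα
  obtain ⟨Y₂, _, _, ν₂, _, β₂, hβ₂⟩ := exists_bernoulli Λ
  -- The diagonal action takes its factor map from the first coordinate and its freeness from the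
  -- second.
  let b : Λ →* Function.End (Y₁ × Y₂) :=
    { toFun := fun g y => (β₁ g y.1, β₂ g y.2)
      map_one' := by
        funext y
        change _ = y
        simp
      map_mul' := by
        intro g g'
        funext y
        change _ = (β₁ g (β₁ g' y.1), β₂ g (β₂ g' y.2))
        simp }
  have hb : ∀ g y, b.toHomPerm g y = (β₁ g y.1, β₂ g y.2) := fun _ _ => rfl
  have hmp : ∀ g, MeasurePreserving (b.toHomPerm g) (ν₁.prod ν₂) (ν₁.prod ν₂) := fun g =>
    (hβ₁ g).prod (hβ₂.measurePreserving g)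
  have hfree : ∀ᵐ y ∂(ν₁.prod ν₂), ∀ g, b.toHomPerm g y = y → g = 1 := by
    filter_upwards [Measure.quasiMeasurePreserving_snd.ae hβ₂.essentiallyFree] with y hy g hg
    exact hy g (congrArg Prod.snd hg)
  obtain ⟨S, hSm, hS, hinv, hSP⟩ := exists_invariant_conull hmp hfree
  refine ⟨S, inferInstance, hSm.standardBorel, (ν₁.prod ν₂).comap (↑),
    isProbabilityMeasure_comap_subtype hSm hS, restrictAction b.toHomPerm S hinv,
    fun y => p y.1.1, ⟨restrictAction_measurePreserving hinv hSm hmp,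
      fun y g hg => hSP y y.2 g (congrArg Subtype.val hg)⟩,
    (hp.comp measurePreserving_fst).comp (measurePreserving_subtype_coe hSm hS),
    fun h y => hpα h y.1.1⟩

/-- A measure preserving action of a group embedded in a countable group is a factor of a strictly
free measure preserving action of the larger group. -/
theorem exists_free_extension_of_injective {Λ Γ : Type*} [Group Λ] [Group Γ] [Countable Λ]
    (j : Γ →* Λ) (hj : Function.Injective j)
    {X : Type} [MeasurableSpace X] [StandardBorelSpace X] (μ : Measure X) [IsProbabilityMeasure μ]
    (α : Γ →* Equiv.Perm X) (hα : ∀ h, MeasurePreserving (α h) μ μ) :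
    ∃ (Y : Type) (_ : MeasurableSpace Y) (_ : StandardBorelSpace Y) (ν : Measure Y)
      (_ : IsProbabilityMeasure ν) (β : Λ →* Equiv.Perm Y) (p : Y → X),
      IsStrictlyFreePMP ν β ∧ MeasurePreserving p ν μ ∧
      ∀ (h : Γ) y, p (β (j h) y) = α h (p y) := by
  -- A countable group has a copy in the lowest universe, where the space of the co-induced action
  -- has to live.
  let e : Λ ≃* Shrink.{0} Λ := Shrink.mulEquiv.symm
  have : Countable (Shrink.{0} Λ) := e.symm.injective.countable
  let i : Γ →* Shrink.{0} Λ := e.toMonoidHom.comp j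
  have hi : Function.Injective i := e.injective.comp hj
  let r := MonoidHom.ofInjective hi
  obtain ⟨Y, _, _, ν, _, β, p, hβ, hp, hpα⟩ := exists_free_extension i.range μ
    (α.comp r.symm.toMonoidHom) fun h => hα _
  refine ⟨Y, inferInstance, inferInstance, ν, inferInstance, β.comp e.toMonoidHom, p,
    hβ.comp _ e.injective, hp, fun h y => ?_⟩
  have h₁ := hpα (r h) y
  have h₂ : r.symm (r h) = h := r.symm_apply_apply h
  simp only [MonoidHom.comp_apply, MulEquiv.coe_toMonoidHom, h₂] at h₁
  exact h₁

end Extension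

/-! ## Orbit equivalence of amalgamated products -/

section AmalgProd

open Monoid

variable {H G K : Type u} [Group H] [Group G] [Group K] (f : H →* G) (k : H →* K)

/-- The canonical homomorphism `K → G *_H K`. -/
def AmalgProd.inr : K →* AmalgProd f k :=
  PushoutI.of (φ := amalgMap f k) true

theorem amalgMap_injective (hf : Function.Injective f) (hk : Function.Injective k) :
    ∀ b, Function.Injective (amalgMap f k b)
  | false => hf
  | true => hk

theorem AmalgProd.inl_injective (hf : Function.Injective f) (hk : Function.Injective k) :
    Function.Injective (AmalgProd.inl f k) :=
  PushoutI.of_injective (amalgMap_injective f k hf hk) false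

theorem AmalgProd.inr_injective (hf : Function.Injective f) (hk : Function.Injective k) :
    Function.Injective (AmalgProd.inr f k) :=
  PushoutI.of_injective (amalgMap_injective f k hf hk) true

theorem AmalgProd.inl_apply (h : H) :
    AmalgProd.inl f k (f h) = PushoutI.base (amalgMap f k) h :=
  PushoutI.of_apply_eq_base (amalgMap f k) false h

theorem AmalgProd.inr_apply (h : H) :
    AmalgProd.inr f k (k h) = PushoutI.base (amalgMap f k) h :=
  PushoutI.of_apply_eq_base (amalgMap f k) true h

theorem AmalgProd.countable [Countable H] [Countable G] [Countable K] :
    Countable (AmalgProd f k) := by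
  have : ∀ b, Countable (AmalgFactor G K b) := by
    rintro (_ | _)
    · exact inferInstanceAs (Countable G)
    · exact inferInstanceAs (Countable K)
  exact amalgam_countable

variable {f k}

/-- The homomorphism out of an amalgamated product given by compatible homomorphisms. -/
def AmalgProd.lift {P : Type*} [Group P] (a : G →* P) (b : K →* P)
    (h : ∀ x, a (f x) = b (k x)) : AmalgProd f k →* P :=
  PushoutI.lift (φ := amalgMap f k)
    (fun i => match i with
      | false => a
      | true => b)
    (a.comp f) (by
      rintro (_ | _)
      · rfl
      · exact MonoidHom.ext fun x => (h x).symm)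

@[simp]
theorem AmalgProd.lift_inl {P : Type*} [Group P] (a : G →* P) (b : K →* P)
    (h : ∀ x, a (f x) = b (k x)) (g : G) : AmalgProd.lift a b h (AmalgProd.inl f k g) = a g :=
  PushoutI.lift_of (φ := amalgMap f k) _ _ _ (i := false) g

@[simp]
theorem AmalgProd.lift_inr {P : Type*} [Group P] (a : G →* P) (b : K →* P)
    (h : ∀ x, a (f x) = b (k x)) (g : K) : AmalgProd.lift a b h (AmalgProd.inr f k g) = b g :=
  PushoutI.lift_of (φ := amalgMap f k) _ _ _ (i := true) g

@[elab_as_elim]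
theorem AmalgProd.induction_on {motive : AmalgProd f k → Prop} (x : AmalgProd f k)
    (inl : ∀ g, motive (AmalgProd.inl f k g)) (inr : ∀ g, motive (AmalgProd.inr f k g))
    (mul : ∀ x y, motive x → motive y → motive (x * y)) : motive x := by
  refine PushoutI.induction_on x ?_ (fun h => AmalgProd.inl_apply f k h ▸ inl (f h)) mul
  rintro (_ | _) g
  · exact inl g
  · exact inr g

theorem AmalgProd.hom_ext {P : Type*} [Group P] {a b : AmalgProd f k →* P}
    (hl : ∀ g, a (AmalgProd.inl f k g) = b (AmalgProd.inl f k g))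
    (hr : ∀ g, a (AmalgProd.inr f k g) = b (AmalgProd.inr f k g)) : a = b := by
  refine MonoidHom.ext fun x => ?_
  induction x using AmalgProd.induction_on with
  | inl g => exact hl g
  | inr g => exact hr g
  | mul x y hx hy => rw [map_mul, map_mul, hx, hy]

/-- Suppose that `G *_H K₁` acts strictly freely and `G *_H K₂` acts such that the actions of `G`
agree and the orbits of `K₁` and `K₂`, and of their common subgroup `H`, coincide at every point.
If `K₂` acts strictly freely, then so does `G *_H K₂`, and the orbits coincide. -/
theorem isStrictPairOE_amalgProd {K₁ K₂ : Type u} {Y : Type*} [Group K₁] [Group K₂]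
    [MeasurableSpace Y]
    {ν : Measure Y} {k₁ : H →* K₁} {k₂ : H →* K₂} (hf : Function.Injective f)
    (hk₁ : Function.Injective k₁) (hk₂ : Function.Injective k₂)
    (β₁ : AmalgProd f k₁ →* Equiv.Perm Y) (β₂ : AmalgProd f k₂ →* Equiv.Perm Y)
    (hβ₁ : IsStrictlyFreePMP ν β₁)
    (hK₂ : IsStrictlyFreePMP ν (β₂.comp (AmalgProd.inr f k₂)))
    (hG : ∀ g, β₁ (AmalgProd.inl f k₁ g) = β₂ (AmalgProd.inl f k₂ g))
    (hK : ∀ x y, (∃ g, β₁ (AmalgProd.inr f k₁ g) x = y) ↔ ∃ g, β₂ (AmalgProd.inr f k₂ g) x = y) :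
    IsStrictPairOE ν (AmalgProd.inl f k₁).range (AmalgProd.inl f k₂).range β₁ β₂ := by
  have hbase : ∀ h, β₁ (PushoutI.base (amalgMap f k₁) h) =
      β₂ (PushoutI.base (amalgMap f k₂) h) := fun h => by
    rw [← AmalgProd.inl_apply, ← AmalgProd.inl_apply, hG]
  refine ⟨hβ₁, ⟨fun x => ?_, ?_⟩, fun x y => ⟨?_, ?_⟩, fun x y => ?_⟩
  · induction x using AmalgProd.induction_on with
    | inl g => exact hG g ▸ hβ₁.measurePreserving _
    | inr g => exact hK₂.measurePreserving g
    | mul x y hx hy =>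
      rw [map_mul, Equiv.Perm.coe_mul]
      exact hx.comp hy
  · refine amalgam_action_free (amalgMap_injective f k₁ hf hk₁) (amalgMap_injective f k₂ hf hk₂)
      β₁ β₂ hβ₁.free hbase ?_
    rintro (_ | _) g y hg
    · exact ⟨g, hg, (congrArg (fun p => p y) (hG g)).symm⟩
    -- If the replacement `g'` came from `H`, then `g` and an element of `H` would move `y` alike,
    -- and freeness of `K₂` would put `g` into `H`.
    · obtain ⟨g', hg'⟩ := (hK y (β₂ (AmalgProd.inr f k₂ g) y)).2 ⟨g, rfl⟩
      refine ⟨g', ?_, hg'.symm⟩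
      rintro ⟨h, rfl⟩
      refine hg ⟨h, hK₂.eq_of_apply_eq (x := y) ?_⟩
      change β₂ (AmalgProd.inr f k₂ (k₂ h)) y = β₂ (AmalgProd.inr f k₂ g) y
      rw [← hg', AmalgProd.inr_apply, ← hbase, ← AmalgProd.inr_apply]
      rfl
  · rintro ⟨g, rfl⟩
    obtain ⟨l, hl⟩ := amalgam_orbit_subset β₂ β₁ (fun h y => ⟨_, by rw [hbase]⟩) (by
      rintro (_ | _) g y
      · exact ⟨AmalgProd.inl f k₂ g, congrArg (fun p => p y) (hG g)⟩
      · obtain ⟨l, hl⟩ := (hK y (β₁ (AmalgProd.inr f k₁ g) y)).1 ⟨g, rfl⟩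
        exact ⟨_, hl.symm⟩) g x
    exact ⟨l, hl.symm⟩
  · rintro ⟨g, rfl⟩
    obtain ⟨l, hl⟩ := amalgam_orbit_subset β₁ β₂ (fun h y => ⟨_, by rw [← hbase]⟩) (by
      rintro (_ | _) g y
      · exact ⟨AmalgProd.inl f k₁ g, congrArg (fun p => p y) (hG g).symm⟩
      · obtain ⟨l, hl⟩ := (hK y (β₂ (AmalgProd.inr f k₂ g) y)).2 ⟨g, rfl⟩
        exact ⟨_, hl.symm⟩) g x
    exact ⟨l, hl.symm⟩
  · simp [hG]

end AmalgProd

/-- Orbit equivalence lifts along equivariant maps: if `p : Y → X` is equivariant for `Γ₁` and `Γ₂`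
acts on `X` with the orbits of `Γ₁`, then `Γ₂` acts on `Y` with the orbits of `Γ₁`. -/
theorem exists_lift_of_sameOrbits {Γ₁ Γ₂ X Y : Type*} [Group Γ₁] [Group Γ₂] [Countable Γ₁]
    [MeasurableSpace X] [StandardBorelSpace X] [MeasurableSpace Y] {μ : Measure X} {ν : Measure Y}
    {α₁ : Γ₁ →* Equiv.Perm X} {α₂ : Γ₂ →* Equiv.Perm X}
    (hα₁ : IsStrictlyFreePMP μ α₁) (hα₂ : IsStrictlyFreePMP μ α₂)
    (horb : ∀ x y, (∃ g, α₁ g x = y) ↔ ∃ g, α₂ g x = y)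
    {β₁ : Γ₁ →* Equiv.Perm Y} (hβ₁ : ∀ g, MeasurePreserving (β₁ g) ν ν)
    {p : Y → X} (hp : Measurable p) (hpβ : ∀ g y, p (β₁ g y) = α₁ g (p y)) :
    ∃ β₂ : Γ₂ →* Equiv.Perm Y, IsStrictlyFreePMP ν β₂ ∧
      (∀ x y, (∃ g, β₁ g x = y) ↔ ∃ g, β₂ g x = y) ∧
      ∀ g₁ g₂, (∀ x, α₁ g₁ x = α₂ g₂ x) → β₁ g₁ = β₂ g₂ := by
  have hex : ∀ g x, ∃ k, α₁ k x = α₂ g x := fun g x => (horb x _).2 ⟨g, rfl⟩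
  -- The orbit cocycle: `c g x` moves `x` under `α₁` as `g` does under `α₂`. Freeness of `α₁` makes
  -- it unique, whence the cocycle identity behind `map_mul'`.
  choose c hc using hex
  have hc_eq : ∀ {g k x}, α₁ k x = α₂ g x → c g x = k := fun h =>
    hα₁.eq_of_apply_eq ((hc _ _).trans h.symm)
  let b : Γ₂ →* Function.End Y :=
    { toFun := fun g y => β₁ (c g (p y)) y
      map_one' := by
        funext y
        change _ = y
        have : c 1 (p y) = 1 := hc_eq (by simp)
        simp [this]
      map_mul' := by
        intro g h
        funext y
        change _ = β₁ (c g (p (β₁ (c h (p y)) y))) (β₁ (c h (p y)) y)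
        rw [hpβ, hc, ← Equiv.Perm.mul_apply, ← map_mul]
        congr 2
        exact hc_eq (by simp [hc]) }
  have hb : ∀ g y, b.toHomPerm g y = β₁ (c g (p y)) y := fun _ _ => rfl
  have hpb : ∀ g y, p (b.toHomPerm g y) = α₂ g (p y) := fun g y => by rw [hb, hpβ, hc]
  refine ⟨b.toHomPerm, ⟨fun g => ?_, fun y g hg => ?_⟩, fun x y => ⟨?_, ?_⟩, fun g₁ g₂ h => ?_⟩
  · refine measurePreserving_of_piecewise hβ₁ _ (fun y => c g (p y)) (fun k => ?_) (hb g)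
    -- The pieces are measurable although `c` is chosen pointwise: each is the preimage of a set
    -- where two measurable maps agree.
    have : (fun y => c g (p y)) ⁻¹' {k} = p ⁻¹' {x | α₁ k x = α₂ g x} := by
      ext y
      exact ⟨fun h => by rw [← show c g (p y) = k from h]; exact hc _ _, fun h => hc_eq h⟩
    rw [this]
    exact hp (measurableSet_eq_fun (hα₁.measurePreserving k).measurable
      (hα₂.measurePreserving g).measurable)
  · exact hα₂.free (p y) g (by rw [← hpb, hg])
  · rintro ⟨g, rfl⟩
    obtain ⟨h, hh⟩ := (horb (p x) (α₁ g (p x))).1 ⟨g, rfl⟩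
    exact ⟨h, by rw [hb, hc_eq hh.symm]⟩
  · rintro ⟨g, rfl⟩
    exact ⟨_, (hb g x).symm⟩
  · ext y
    rw [hb, hc_eq (h (p y))]

/-! ### Strong orbit equivalence of amalgams, and the free product case. -/

section Main

open Monoid

/-- A strict orbit equivalence of pairs that agrees on the common subgroup `H` gives a strong orbit
equivalence of amalgamated products over `H`. -/
theorem IsStrictPairOE.strongPairOE_amalgProd {H G Γ₁ Γ₂ : Type u} [Group H] [Group G] [Group Γ₁]
    [Group Γ₂] [Countable G] [Countable Γ₁] {f : H →* G} (hf : Function.Injective f)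
    {k₁ : H →* Γ₁} (hk₁ : Function.Injective k₁) {k₂ : H →* Γ₂} (hk₂ : Function.Injective k₂)
    {X : Type} [MeasurableSpace X] [StandardBorelSpace X] {μ : Measure X} [IsProbabilityMeasure μ]
    {α₁ : Γ₁ →* Equiv.Perm X} {α₂ : Γ₂ →* Equiv.Perm X} {H₁ : Subgroup Γ₁} {H₂ : Subgroup Γ₂}
    (hα : IsStrictPairOE μ H₁ H₂ α₁ α₂) (hH : ∀ h x, α₁ (k₁ h) x = α₂ (k₂ h) x) :
    StrongPairOE (AmalgProd.inl f k₁).range (AmalgProd.inl f k₂).range := by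
  have : Countable H := hf.countable
  have : Countable (AmalgProd f k₁) := AmalgProd.countable f k₁
  obtain ⟨Y, _, _, ν, _, β, p, hβ, hp, hpβ⟩ := exists_free_extension_of_injective
    (AmalgProd.inr f k₁) (AmalgProd.inr_injective f k₁ hf hk₁) μ α₁ hα.left.measurePreserving
  obtain ⟨γ, hγ, horb, heq⟩ := exists_lift_of_sameOrbits hα.left hα.right hα.orbit
    (β₁ := β.comp (AmalgProd.inr f k₁)) (fun g => hβ.measurePreserving _) hp.measurable hpβ
  -- Agreement on `H` lifts from `X` to `Y` by `heq`; this is the compatibility that gluing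
  -- requires.
  let β₂ : AmalgProd f k₂ →* Equiv.Perm Y :=
    AmalgProd.lift (β.comp (AmalgProd.inl f k₁)) γ fun h => by
      rw [← heq (k₁ h) (k₂ h) (hH h), MonoidHom.comp_apply, MonoidHom.comp_apply,
        AmalgProd.inl_apply, AmalgProd.inr_apply]
  have hβ₂ : β₂.comp (AmalgProd.inr f k₂) = γ := MonoidHom.ext fun g => by simp [β₂]
  have hG : ∀ g, β (AmalgProd.inl f k₁ g) = β₂ (AmalgProd.inl f k₂ g) := fun g => by simp [β₂]
  let i₁ := MonoidHom.ofInjective (AmalgProd.inl_injective f k₁ hf hk₁)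
  let i₂ := MonoidHom.ofInjective (AmalgProd.inl_injective f k₂ hf hk₂)
  refine ⟨i₁.symm.trans i₂, Y, inferInstance, inferInstance, ν, inferInstance, β, β₂,
    (isStrictPairOE_amalgProd hf hk₁ hk₂ β β₂ hβ (hβ₂.symm ▸ hγ) hG fun x y => ?_).isPairOE,
    fun g => .of_forall fun x => ?_⟩
  · simpa [β₂] using horb x y
  · obtain ⟨g, rfl⟩ := i₁.surjective g
    rw [MulEquiv.trans_apply, MulEquiv.symm_apply_apply]
    exact congrArg (fun σ => σ x) (hG g)

/-- Countability of `H₁` lets the almost everywhere agreements hold simultaneously on one invariant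
conull set, where the strict version applies. -/
theorem StrongPairOEVia.strongPairOE_amalgProd {H G Γ₁ Γ₂ : Type u} [Group H] [Group G]
    [Group Γ₁] [Group Γ₂] [Countable G] [Countable Γ₁] {f : H →* G} (hf : Function.Injective f)
    {H₁ : Subgroup Γ₁} {H₂ : Subgroup Γ₂} (e₁ : H ≃* H₁) (e₂ : H ≃* H₂)
    (h : StrongPairOEVia H₁ H₂ (e₁.symm.trans e₂)) :
    StrongPairOE (AmalgProd.inl f (H₁.subtype.comp e₁.toMonoidHom)).range
      (AmalgProd.inl f (H₂.subtype.comp e₂.toMonoidHom)).range := by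
  obtain ⟨X, _, _, μ, _, α₁, α₂, hα, hφ⟩ := h
  obtain ⟨S, h₁, h₂, hSm, hS, hP, hstrict⟩ := hα.exists_strict (ae_all_iff.2 hφ)
  have := hSm.standardBorel
  have := isProbabilityMeasure_comap_subtype hSm hS
  refine hstrict.strongPairOE_amalgProd hf (H₁.subtype_injective.comp e₁.injective)
    (H₂.subtype_injective.comp e₂.injective) fun h x => Subtype.ext ?_
  simpa using hP x x.2 (e₁ h)

theorem StrongPairOE.map_right {Γ₁ Γ₂ Γ₃ : Type*} [Group Γ₁] [Group Γ₂] [Group Γ₃]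
    {H₁ : Subgroup Γ₁} {H₂ : Subgroup Γ₂} (h : StrongPairOE H₁ H₂) (e : Γ₂ ≃* Γ₃) :
    StrongPairOE H₁ (H₂.map e.toMonoidHom) := by
  obtain ⟨φ, X, _, _, μ, _, α₁, α₂, hα, hφ⟩ := h
  refine ⟨φ.trans (e.subgroupMap H₂), X, inferInstance, inferInstance, μ, inferInstance, α₁,
    α₂.comp e.symm.toMonoidHom, ⟨hα.left, ⟨fun g => hα.right.measurePreserving _, ?_⟩, ?_, ?_⟩, ?_⟩
  · filter_upwards [hα.right.essentiallyFree] with x hx g hg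
    exact e.symm.map_eq_one_iff.1 (hx _ hg)
  · filter_upwards [hα.sameOrbits] with x hx y
    rw [hx y]
    exact ⟨fun ⟨g, _, hg⟩ => ⟨e g, trivial, by simpa using hg⟩, fun ⟨g, _, hg⟩ => ⟨_, trivial, hg⟩⟩
  · filter_upwards [hα.sameSubOrbits] with x hx y
    rw [hx y]
    simp
  · intro γ
    filter_upwards [hφ γ] with x hx
    change α₁ γ x = α₂ (e.symm (e (φ γ))) x
    rw [e.symm_apply_apply, hx]

/-- `G *_H (K * L) ≃ G * L` if `H ≃ K`. -/
theorem exists_amalgProd_coprod_mulEquiv {H G K L : Type u} [Group H] [Group G] [Group K] [Group L]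
    (f : H →* G) (e : H ≃* K) (k : H →* Coprod K L) (hk : ∀ h, k h = Coprod.inl (e h)) :
    ∃ i : AmalgProd f k ≃* Coprod G L, ∀ g, i (AmalgProd.inl f k g) = Coprod.inl g := by
  let a : AmalgProd f k →* Coprod G L := AmalgProd.lift Coprod.inl
    (Coprod.lift (Coprod.inl.comp (f.comp e.symm.toMonoidHom)) Coprod.inr) fun h => by simp [hk]
  let b : Coprod G L →* AmalgProd f k :=
    Coprod.lift (AmalgProd.inl f k) ((AmalgProd.inr f k).comp Coprod.inr)
  -- The factor `K` of `K * L` is identified with the image of `H` in `G`, so a map defined on `G`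
  -- and `L` alone can be inverse to `a`.
  have hbl : ∀ h : K, AmalgProd.inl f k (f (e.symm h)) = AmalgProd.inr f k (Coprod.inl h) :=
    fun h => by
      have := hk (e.symm h)
      rw [e.apply_symm_apply] at this
      rw [AmalgProd.inl_apply, ← AmalgProd.inr_apply, this]
  have hba : b.comp a = MonoidHom.id _ := by
    refine AmalgProd.hom_ext (fun g => by simp [a, b]) fun g => ?_
    have : ((b.comp a).comp (AmalgProd.inr f k)) = AmalgProd.inr f k :=
      Coprod.hom_ext (MonoidHom.ext fun g => by simp [a, b, hbl])
        (MonoidHom.ext fun g => by simp [a, b])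
    exact DFunLike.congr_fun this g
  have hab : a.comp b = MonoidHom.id _ :=
    Coprod.hom_ext (MonoidHom.ext fun g => by simp [a, b]) (MonoidHom.ext fun g => by simp [a, b])
  exact ⟨MonoidHom.toMulEquiv a b hba hab, fun g => by simp [a]⟩

/-- An orbit equivalence of `H < Γ` and `H < H * L` can be made strong. -/
theorem PairOE.strongPairOEVia_coprod {Γ L : Type u} [Group Γ] [Countable Γ] [Group L]
    (H : Subgroup Γ)
    (h : PairOE H (Coprod.inl : H →* Coprod H L).range) :
    StrongPairOEVia H (Coprod.inl : H →* Coprod H L).range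
      (MonoidHom.ofInjective Coprod.inl_injective) := by
  obtain ⟨X, _, _, μ, _, α₁, α₂, hα⟩ := h
  obtain ⟨S, h₁, h₂, hSm, hS, -, hstrict⟩ := hα.exists_strict (P := fun _ => True) (by simp)
  have := hSm.standardBorel
  have := isProbabilityMeasure_comap_subtype hSm hS
  generalize restrictAction α₁ S h₁ = α₁ at hstrict
  generalize restrictAction α₂ S h₂ = α₂ at hstrict
  generalize μ.comap ((↑) : S → X) = μ at *
  -- `H * L` is viewed as an amalgam over the trivial group, with `L` as the factor whose action is
  -- kept.
  let t : PUnit.{u + 1} →* L := 1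
  let s : PUnit.{u + 1} →* H := 1
  have ht : Function.Injective t := Function.injective_of_subsingleton t
  have hs : Function.Injective s := Function.injective_of_subsingleton s
  let a : AmalgProd t s →* Coprod H L := AmalgProd.lift Coprod.inr Coprod.inl fun _ => by simp [s, t]
  let b : Coprod H L →* AmalgProd t s := Coprod.lift (AmalgProd.inr t s) (AmalgProd.inl t s)
  have hba : ∀ x, b (a x) = x := DFunLike.congr_fun (f := b.comp a) (g := MonoidHom.id _)
    (AmalgProd.hom_ext (fun g => by simp [a, b]) fun g => by simp [a, b])
  have hab : ∀ x, a (b x) = x := DFunLike.congr_fun (f := a.comp b) (g := MonoidHom.id _)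
    (Coprod.hom_ext (MonoidHom.ext fun g => by simp [a, b]) (MonoidHom.ext fun g => by simp [a, b]))
  -- `L` acts as in `α₂`, while `H` now acts through `α₁`; by `hstrict.subOrbit` this leaves the
  -- orbits of `H` unchanged.
  let α₃ : AmalgProd t s →* Equiv.Perm S :=
    AmalgProd.lift (α₂.comp Coprod.inr) (α₁.comp H.subtype) fun _ => by simp [s, t]
  have key := isStrictPairOE_amalgProd ht hs hs (α₂.comp a) α₃
    (hstrict.right.comp a (Function.LeftInverse.injective hba))
    (by
      have : α₃.comp (AmalgProd.inr t s) = α₁.comp H.subtype := MonoidHom.ext fun g => by simp [α₃]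
      rw [this]
      exact hstrict.left.comp _ H.subtype_injective)
    (fun g => by simp [a, α₃]) fun x y => by
      simpa [a, α₃] using (hstrict.subOrbit x y).symm
  have hb : Function.Injective b := Function.LeftInverse.injective hab
  have hinl : ∀ γ : H, α₃ (b (Coprod.inl γ)) = α₁ γ := fun γ => by simp [α₃, b]
  refine ⟨S, inferInstance, inferInstance, μ, inferInstance, α₁, α₃.comp b,
    IsStrictPairOE.isPairOE ⟨hstrict.left, key.right.comp b hb, fun x y => ?_, fun x y => ?_⟩,
    fun γ => .of_forall fun x => ?_⟩
  · rw [hstrict.orbit]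
    refine Iff.trans ⟨?_, ?_⟩ ((key.orbit x y).trans ⟨?_, ?_⟩)
    · rintro ⟨g, rfl⟩
      exact ⟨b g, by simp [hab]⟩
    · rintro ⟨g, rfl⟩
      exact ⟨a g, rfl⟩
    · rintro ⟨g, rfl⟩
      exact ⟨a g, by simp [hba]⟩
    · rintro ⟨g, rfl⟩
      exact ⟨b g, rfl⟩
  · simp [hinl]
  · exact congrArg (fun σ => σ x) (hinl γ).symm

end Main

theorem mainTheorem5
    (G : Type u) [Group G] [Countable G] (Γ₀ : Subgroup G)
    (Γ₁ : Type u) [Group Γ₁] [Countable Γ₁] (Γ₁₀ : Subgroup Γ₁) (e₁ : Γ₀ ≃* Γ₁₀) :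
    (∀ (Γ₂ : Type u) [Group Γ₂] [Countable Γ₂] (Γ₂₀ : Subgroup Γ₂) (e₂ : Γ₀ ≃* Γ₂₀),
      StrongPairOEVia Γ₁₀ Γ₂₀ (e₁.symm.trans e₂) →
      StrongPairOE
        (AmalgProd.inl Γ₀.subtype (Γ₁₀.subtype.comp e₁.toMonoidHom)).range
        (AmalgProd.inl Γ₀.subtype (Γ₂₀.subtype.comp e₂.toMonoidHom)).range) ∧
    (∀ (Γ₂' : Type u) [Group Γ₂'] [Countable Γ₂'],
      PairOE Γ₁₀ (Monoid.Coprod.inl : Γ₁₀ →* Monoid.Coprod Γ₁₀ Γ₂').range →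
      StrongPairOE
        (AmalgProd.inl Γ₀.subtype (Γ₁₀.subtype.comp e₁.toMonoidHom)).range
        (Monoid.Coprod.inl : G →* Monoid.Coprod G Γ₂').range) := by
  refine ⟨fun Γ₂ _ _ Γ₂₀ e₂ h => h.strongPairOE_amalgProd Γ₀.subtype_injective, fun L _ _ h => ?_⟩
  let r := MonoidHom.ofInjective (Monoid.Coprod.inl_injective (M := Γ₁₀) (N := L))
  have h₁ := h.strongPairOEVia_coprod
  -- Part (1) is used with the free product as second group and `e₁` followed by its inclusion as
  -- `e₂`, so that `e₂ ∘ e₁⁻¹` is the inclusion itself.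
  have h₂ : e₁.symm.trans (e₁.trans r) = r := by ext; simp
  have h₃ := StrongPairOEVia.strongPairOE_amalgProd Γ₀.subtype_injective e₁ (e₁.trans r)
    (h₂.symm ▸ h₁)
  obtain ⟨i, hi⟩ := exists_amalgProd_coprod_mulEquiv (L := L) Γ₀.subtype e₁
    (Subgroup.subtype _ |>.comp (e₁.trans r).toMonoidHom) fun _ => rfl
  have h₄ := h₃.map_right i
  rw [MonoidHom.map_range] at h₄
  convert h₄ using 2
  exact MonoidHom.ext fun g => (hi g).symm
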